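/- Let $m,n$ be positive integers and $r$ a non-negative integer with $(m,n)=(m,r-1)=1$ and $r^n\equiv 1 \pmod m$, where $(x,y)$ denotes the greatest common divisor. Let $$ZM(m,n,r)=\langle a,b \mid a^m=b^n=1,\ b^{-1}ab=a^r\rangle .$$ For a finite group $G$ let $L(G)$ be the set of its subgroups, let $$sd(G)=\frac{1}{|L(G)|^2}\,\bigl|\{(H,K)\in L(G)^2 \mid HK=KH\}\bigr|$$ be its subgroup commutativity degree and let $F_2(G)=|\{(H,K)\in L(G)^2 \mid HK=G\}|$ be its factorization number. For $m_1\mid m$ and $n_1\mid n$ let $H(m_1,n_1,0)=\langle a^{m_1},b^{n_1}\rangle\le ZM(m,n,r)$ and $f_{m_1,n_1}=F_2(H(m_1,n_1,0))$. Then $$sd(ZM(m,n,r))=\frac{\sum_{m_1\mid m}\sum_{n_1\mid n}\bigl(m_1,\frac{r^n-1}{r^{n_1}-1}\bigr)f_{m_1,n_1}}{\Bigl[\sum_{m_1\mid m}\sum_{n_1\mid n}\bigl(m_1,\frac{r^n-1}{r^{n_1}-1}\bigr)\Bigr]^2},$$ and, for all $m_1\mid m$ and $n_1\mid n$, $$f_{m_1,n_1}=\sum_{\substack{m_2,m_3\mid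 m,\ (m_2,m_3)=m_1\\ n_2,n_3\mid n,\ (n_2,n_3)=n_1}}\Bigl(\frac{m_2}{m_1},\frac{r^n-1}{r^{n_2}-1}\Bigr)\Bigl(\frac{m_3}{m_1},\frac{r^n-1}{r^{n_3}-1}\Bigr).$$ (All sums run over positive divisors. If $r\in\{0,1\}$ then $m=1$, and each of these greatest common divisors is $1$.) In particular, $sd(ZM(9,4,8))=\frac{13}{19}$. -/

import Mathlib

open scoped Pointwise

namespace ZMGroup

/-- The conditions on the parameters `(m, n, r)` of a ZM-group:
`(m, n) = (m, r - 1) = 1` and `r ^ n ≡ 1 (mod m)`, with `m` and `n` positive.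
The difference `r - 1` is taken in `ℤ`. -/
structure IsZMTriple (m n r : ℕ) : Prop where
  m_pos : 0 < m
  n_pos : 0 < n
  coprime : Nat.Coprime m n
  coprime_sub_one : IsCoprime (m : ℤ) ((r : ℤ) - 1)
  pow_modEq : r ^ n ≡ 1 [MOD m]

/-- The relators `a ^ m`, `b ^ n` and `b⁻¹ a b a ^ (-r)`, where the free generators are
`a = FreeGroup.of 0` and `b = FreeGroup.of 1`. -/
def relators (m n r : ℕ) : Set (FreeGroup (Fin 2)) :=
  {FreeGroup.of 0 ^ m, FreeGroup.of 1 ^ n,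
    (FreeGroup.of 1)⁻¹ * FreeGroup.of 0 * FreeGroup.of 1 * (FreeGroup.of 0 ^ r)⁻¹}

/-- The group `ZM(m, n, r) = ⟨a, b | a ^ m = b ^ n = 1, b⁻¹ a b = a ^ r⟩`. -/
abbrev ZM (m n r : ℕ) : Type := PresentedGroup (relators m n r)

/-- The generator `a` of `ZM(m, n, r)`. -/
def genA (m n r : ℕ) : ZM m n r := PresentedGroup.of 0

/-- The generator `b` of `ZM(m, n, r)`. -/
def genB (m n r : ℕ) : ZM m n r := PresentedGroup.of 1

/-- The subgroup `H(m₁, n₁, s) = ⟨a ^ m₁, b ^ n₁ a ^ s⟩` of `ZM(m, n, r)`. -/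
def H (m n r m₁ n₁ s : ℕ) : Subgroup (ZM m n r) :=
  Subgroup.closure {genA m n r ^ m₁, genB m n r ^ n₁ * genA m n r ^ s}

/-- The factorization number `F₂(G)`: the number of pairs `(H, K)` of subgroups with `HK = G`. -/
noncomputable def factorizationNumber (G : Type*) [Group G] : ℕ :=
  Nat.card {p : Subgroup G × Subgroup G // (p.1 : Set G) * (p.2 : Set G) = Set.univ}

/-- The subgroup commutativity degree `sd(G)`: the proportion, among all pairs `(H, K)` of
subgroups of the (finite) group `G`, of the pairs with `HK = KH`. -/
noncomputable def subgroupCommutativityDegree (G : Type*) [Group G] : ℚ :=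
  (Nat.card {p : Subgroup G × Subgroup G //
      (p.1 : Set G) * (p.2 : Set G) = (p.2 : Set G) * (p.1 : Set G)} : ℚ) /
    (Nat.card (Subgroup G) : ℚ) ^ 2

/-- The quotient `(r ^ n - 1) / (r ^ n₁ - 1)`; the division is exact when `n₁ ∣ n`. It is only used
inside `Nat.gcd d _` with `d ∣ m`; the degenerate values `r = 0, 1` force `m = 1` in a ZM-triple,
and then the gcd is `1`. -/
def powQuot (n r n₁ : ℕ) : ℕ := (r ^ n - 1) / (r ^ n₁ - 1)

/-- The quantity `f_{m₁, n₁} = F₂(H(m₁, n₁, 0))`. -/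
noncomputable def f (m n r m₁ n₁ : ℕ) : ℕ := factorizationNumber (H m n r m₁ n₁ 0)

end ZMGroup

/-! Write every element uniquely as `b ^ i * a ^ j`. A subgroup is then given by its trace `⟨a ^
m₁⟩` on `⟨a⟩`, its image modulo `⟨a⟩`, generated by the class of `b ^ n₁`, and a residue `s` modulo
`m₁` with `b ^ n₁ * a ^ s` in it. The admissible `s` are those for which `m₁` divides `s` times the
geometric sum `(r ^ n - 1) / (r ^ n₁ - 1)`; counting them gives the gcds (`ncard_subgroups`).

`HK = KH` holds exactly when `HK = H ⊔ K`, so the permuting pairs, sorted by their join `L`, number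
`∑ F₂(L)`. Subgroups with the same `(m₁, n₁)` are conjugate (`exists_conj`), so `F₂(L)` is `f` of
the invariants. Inside `L`, whether `HK = L` depends only on the invariants of `H` and `K`
(`mul_eq_iff`), so `f` is itself a sum of products of subgroup counts. -/

namespace ZMGroup

/-! ### Normal forms and the invariants of a subgroup -/

/-- `a` and `b` generate `G`, satisfy the relations of `ZM(m, n, r)`, and every element of `G` has a
unique normal form `b ^ i * a ^ j` with `i` modulo `n` and `j` modulo `m`. -/
structure IsZMPair (m n r : ℕ) {G : Type*} [Group G] (a b : G) : Prop where
  m_pos : 0 < m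
  n_pos : 0 < n
  coprime : Nat.Coprime m n
  a_pow : a ^ m = 1
  b_pow : b ^ n = 1
  comm : a * b = b * a ^ r
  eq_imp : ∀ (i k : ℕ) (j l : ℤ), b ^ i * a ^ j = b ^ k * a ^ l →
    i ≡ k [MOD n] ∧ (m : ℤ) ∣ j - l
  exists_eq : ∀ g : G, ∃ (i : ℕ) (j : ℤ), g = b ^ i * a ^ j

lemma zpow_mul_pow_of_comm {G : Type*} [Group G] {a b : G} {r : ℕ} (h : a * b = b * a ^ r)
    (j : ℤ) (i : ℕ) : a ^ j * b ^ i = b ^ i * a ^ (j * (r : ℤ) ^ i) := by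
  have h1 : ∀ j : ℤ, a ^ j * b = b * a ^ (j * (r : ℤ)) := by
    intro j
    have : SemiconjBy b (a ^ r) a := h.symm
    have := this.zpow_right j
    rw [mul_comm j, zpow_mul, zpow_natCast]
    exact this.eq.symm
  induction i generalizing j with
  | zero => simp
  | succ i ih =>
    rw [pow_succ', ← mul_assoc, h1, mul_assoc, ih, ← mul_assoc, pow_succ', mul_assoc j]

/-- The geometric sum `1 + r ^ d + ⋯ + r ^ (d (k - 1))`. -/
def geomSum (r d k : ℕ) : ℤ := ∑ t ∈ Finset.range k, ((r : ℤ) ^ d) ^ t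

lemma geomSum_succ (r d k : ℕ) : geomSum r d (k + 1) = geomSum r d k * (r : ℤ) ^ d + 1 := by
  rw [geomSum, Finset.sum_range_succ', geomSum, Finset.sum_mul]
  simp [pow_succ]

lemma geomSum_add (r d k l : ℕ) :
    geomSum r d (k + l) = geomSum r d k * (r : ℤ) ^ (d * l) + geomSum r d l := by
  induction l with
  | zero => simp [geomSum]
  | succ l ih => rw [← add_assoc, geomSum_succ, ih, geomSum_succ]; ring

/-- The subgroup `H` meets `⟨a⟩` in `⟨a ^ m₁⟩`, and its image modulo `⟨a⟩` is generated by the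
class of `b ^ n₁`. -/
def HasInvariants {G : Type*} [Group G] (a b : G) (H : Subgroup G) (m₁ n₁ : ℕ) : Prop :=
  (∀ j : ℤ, a ^ j ∈ H ↔ (m₁ : ℤ) ∣ j) ∧ ∀ i : ℕ, (∃ j : ℤ, b ^ i * a ^ j ∈ H) ↔ n₁ ∣ i

lemma HasInvariants.unique {G : Type*} [Group G] {a b : G} {H : Subgroup G} {m₁ n₁ m₂ n₂ : ℕ}
    (h₁ : HasInvariants a b H m₁ n₁) (h₂ : HasInvariants a b H m₂ n₂) : m₁ = m₂ ∧ n₁ = n₂ := by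
  refine ⟨Nat.dvd_antisymm ?_ ?_, Nat.dvd_antisymm ?_ ?_⟩
  · exact Int.natCast_dvd_natCast.1 ((h₁.1 _).1 ((h₂.1 _).2 dvd_rfl))
  · exact Int.natCast_dvd_natCast.1 ((h₂.1 _).1 ((h₁.1 _).2 dvd_rfl))
  · exact (h₁.2 _).1 ((h₂.2 _).2 dvd_rfl)
  · exact (h₂.2 _).1 ((h₁.2 _).2 dvd_rfl)

lemma hasInvariants_top {G : Type*} [Group G] (a b : G) : HasInvariants a b ⊤ 1 1 := by
  constructor <;> simp

namespace IsZMPair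

variable {m n r : ℕ} {G : Type*} [Group G] {a b : G}

lemma zpow_mul_pow (h : IsZMPair m n r a b) (j : ℤ) (i : ℕ) :
    a ^ j * b ^ i = b ^ i * a ^ (j * (r : ℤ) ^ i) :=
  zpow_mul_pow_of_comm h.comm j i

lemma mul_eq (h : IsZMPair m n r a b) (i k : ℕ) (j l : ℤ) :
    b ^ i * a ^ j * (b ^ k * a ^ l) = b ^ (i + k) * a ^ (j * (r : ℤ) ^ k + l) := by
  rw [mul_assoc, ← mul_assoc (a ^ j), h.zpow_mul_pow, pow_add, zpow_add]
  group

lemma pow_eq (h : IsZMPair m n r a b) (i k : ℕ) (s : ℤ) :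
    (b ^ i * a ^ s) ^ k = b ^ (i * k) * a ^ (s * geomSum r i k) := by
  induction k with
  | zero => simp [geomSum]
  | succ k ih =>
    rw [pow_succ, ih, h.mul_eq, geomSum_succ]
    congr 2
    ring

lemma a_zpow_eq_one (h : IsZMPair m n r a b) {j : ℤ} (hj : (m : ℤ) ∣ j) : a ^ j = 1 := by
  obtain ⟨c, rfl⟩ := hj
  rw [zpow_mul, zpow_natCast, h.a_pow, one_zpow]

lemma b_pow_congr (h : IsZMPair m n r a b) {i k : ℕ} (hik : i ≡ k [MOD n]) : b ^ i = b ^ k :=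
  pow_eq_pow_of_modEq hik h.b_pow

lemma exists_lt (h : IsZMPair m n r a b) (g : G) :
    ∃ i < n, ∃ j < m, g = b ^ i * a ^ (j : ℤ) := by
  obtain ⟨i, j, rfl⟩ := h.exists_eq g
  have hm : (0 : ℤ) < m := by exact_mod_cast h.m_pos
  refine ⟨i % n, Nat.mod_lt _ h.n_pos, (j % m).toNat, ?_, ?_⟩
  · have := Int.emod_lt_of_pos j hm
    have := Int.emod_nonneg j hm.ne'
    omega
  · rw [h.b_pow_congr (Nat.mod_modEq i n), Int.toNat_of_nonneg (Int.emod_nonneg j hm.ne')]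
    congr 1
    rw [← mul_inv_eq_one, ← zpow_neg, ← zpow_add]
    apply h.a_zpow_eq_one
    rw [← sub_eq_add_neg]
    exact Int.dvd_self_sub_emod

lemma finite (h : IsZMPair m n r a b) : Finite G := by
  refine Finite.of_surjective (fun p : Fin n × Fin m => b ^ (p.1 : ℕ) * a ^ ((p.2 : ℕ) : ℤ)) ?_
  intro g
  obtain ⟨i, hi, j, hj, rfl⟩ := h.exists_lt g
  exact ⟨(⟨i, hi⟩, ⟨j, hj⟩), rfl⟩

lemma m_dvd (h : IsZMPair m n r a b) {H : Subgroup G} {m₁ n₁ : ℕ}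
    (hH : HasInvariants a b H m₁ n₁) : m₁ ∣ m := by
  rw [← Int.natCast_dvd_natCast, ← hH.1, zpow_natCast, h.a_pow]
  exact H.one_mem

lemma n_dvd (h : IsZMPair m n r a b) {H : Subgroup G} {m₁ n₁ : ℕ}
    (hH : HasInvariants a b H m₁ n₁) : n₁ ∣ n := by
  rw [← hH.2, h.b_pow]
  exact ⟨0, by simp⟩

/-- If `b ^ i a ^ s` lies in `H`, then membership of `b ^ (i k) a ^ j` is decided in `⟨a⟩`. -/
lemma mem_iff_zpow_mem (h : IsZMPair m n r a b) {H : Subgroup G} {i : ℕ} {s : ℤ}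
    (hs : b ^ i * a ^ s ∈ H) (k : ℕ) (j : ℤ) :
    b ^ (i * k) * a ^ j ∈ H ↔ a ^ (j - s * geomSum r i k) ∈ H := by
  have h1 := H.pow_mem hs k
  rw [h.pow_eq] at h1
  rw [← H.mul_mem_cancel_left h1 (y := a ^ (j - _)), mul_assoc, ← zpow_add, add_sub_cancel]

lemma mem_iff_dvd_sub (h : IsZMPair m n r a b) {H : Subgroup G} {m₁ n₁ : ℕ}
    (hH : HasInvariants a b H m₁ n₁) {i : ℕ} {s : ℤ} (hs : b ^ i * a ^ s ∈ H) (j : ℤ) :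
    b ^ i * a ^ j ∈ H ↔ (m₁ : ℤ) ∣ j - s := by
  have := h.mem_iff_zpow_mem hs 1 j
  rw [← hH.1]
  simpa [geomSum] using this

/-- The exponents `j` with `a ^ j ∈ H` form a subgroup of `ℤ`, hence cyclic. For the `b`-part, take
the least positive exponent that occurs and divide with remainder. -/
lemma exists_hasInvariants (h : IsZMPair m n r a b) (H : Subgroup G) :
    ∃ m₁ n₁, HasInvariants a b H m₁ n₁ := by
  classical
  obtain ⟨m₁, hm₁⟩ : ∃ m₁ : ℕ, ∀ j : ℤ, a ^ j ∈ H ↔ (m₁ : ℤ) ∣ j := by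
    let S : AddSubgroup ℤ :=
      { carrier := {j | a ^ j ∈ H}
        zero_mem' := by simp
        add_mem' := fun {x y} hx hy => by
          change a ^ (x + y) ∈ H
          rw [zpow_add]
          exact H.mul_mem hx hy
        neg_mem' := fun {x} hx => by
          change a ^ (-x) ∈ H
          rw [zpow_neg]
          exact H.inv_mem hx }
    obtain ⟨c, hc⟩ := Int.subgroup_cyclic S
    refine ⟨c.natAbs, fun j => ?_⟩
    rw [Int.natAbs_dvd, ← Int.mem_zmultiples_iff, AddSubgroup.zmultiples_eq_closure, ← hc]
    rfl
  have hex : ∃ i : ℕ, 0 < i ∧ ∃ j : ℤ, b ^ i * a ^ j ∈ H :=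
    ⟨n, h.n_pos, 0, by simp [h.b_pow]⟩
  obtain ⟨hpos, s, hs⟩ := Nat.find_spec hex
  refine ⟨m₁, Nat.find hex, hm₁, fun i => ⟨fun ⟨j, hj⟩ => ?_, ?_⟩⟩
  · set d := Nat.find hex with hd
    rw [Nat.dvd_iff_mod_eq_zero]
    by_contra hne
    refine Nat.find_min hex (Nat.mod_lt i hpos) ⟨Nat.pos_of_ne_zero hne, ?_⟩
    have h1 := H.pow_mem hs (i / d)
    rw [h.pow_eq] at h1
    set l := s * geomSum r d (i / d)
    refine ⟨j - l * (r : ℤ) ^ (i % d), ?_⟩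
    rw [← H.mul_mem_cancel_left h1, h.mul_eq, ← hd, Nat.div_add_mod, add_sub_cancel]
    exact hj
  · rintro ⟨k, rfl⟩
    refine ⟨s * geomSum r (Nat.find hex) k, ?_⟩
    rw [← h.pow_eq]
    exact H.pow_mem hs k

/-- `H` is generated by `a ^ m₁` and `b ^ n₁ * a ^ s`. Hence the invariants together with `s`
determine `H`. -/
lemma le_iff (h : IsZMPair m n r a b) {H K : Subgroup G} {m₁ n₁ : ℕ} {s : ℤ}
    (hH : HasInvariants a b H m₁ n₁) (hs : b ^ n₁ * a ^ s ∈ H) :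
    H ≤ K ↔ a ^ (m₁ : ℤ) ∈ K ∧ b ^ n₁ * a ^ s ∈ K := by
  refine ⟨fun hle => ⟨hle ((hH.1 _).2 dvd_rfl), hle hs⟩, fun ⟨h1, h2⟩ g hg => ?_⟩
  obtain ⟨i, j, rfl⟩ := h.exists_eq g
  obtain ⟨k, rfl⟩ := (hH.2 i).1 ⟨j, hg⟩
  rw [h.mem_iff_zpow_mem h2]
  rw [h.mem_iff_zpow_mem hs, hH.1] at hg
  obtain ⟨c, hc⟩ := hg
  rw [hc, zpow_mul]
  exact K.zpow_mem h1 c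

/-- The power of `b ^ n₁ * a ^ s` with exponent `n / n₁` falls into `⟨a⟩ ∩ H`. This necessary
condition on `s` is also sufficient, by `exists_subgroup`. -/
lemma dvd_mul_geomSum (h : IsZMPair m n r a b) {H : Subgroup G} {m₁ n₁ : ℕ} {s : ℤ}
    (hH : HasInvariants a b H m₁ n₁) (hs : b ^ n₁ * a ^ s ∈ H) :
    (m₁ : ℤ) ∣ s * geomSum r n₁ (n / n₁) := by
  have h1 := H.pow_mem hs (n / n₁)
  rwa [h.pow_eq, Nat.mul_div_cancel' (h.n_dvd hH), h.b_pow, one_mul, hH.1] at h1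

/-- Existence of the subgroup `⟨a ^ m₁, b ^ n₁ a ^ s⟩` with prescribed invariants. -/
lemma exists_subgroup (h : IsZMPair m n r a b) {m₁ n₁ : ℕ} (hm : m₁ ∣ m) (hn : n₁ ∣ n) {s : ℤ}
    (hs : (m₁ : ℤ) ∣ s * geomSum r n₁ (n / n₁)) :
    ∃ H : Subgroup G, HasInvariants a b H m₁ n₁ ∧ b ^ n₁ * a ^ s ∈ H := by
  have := h.finite
  have hn₁ : 0 < n₁ := Nat.pos_of_dvd_of_pos hn h.n_pos
  let M : Submonoid G :=
    { carrier := {g | ∃ (k : ℕ) (l : ℤ), g = b ^ (n₁ * k) * a ^ (s * geomSum r n₁ k + m₁ * l)}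
      one_mem' := ⟨0, 0, by simp [geomSum]⟩
      mul_mem' := by
        rintro _ _ ⟨k, l, rfl⟩ ⟨k', l', rfl⟩
        refine ⟨k + k', l * (r : ℤ) ^ (n₁ * k') + l', ?_⟩
        rw [h.mul_eq, geomSum_add, mul_add n₁]
        congr 2
        ring }
  let H : Subgroup G :=
    { M with
      inv_mem' := fun {g} hg => by
        -- In a finite group inverses are positive powers, so a submonoid is a subgroup.
        obtain ⟨k, hk⟩ : ∃ k : ℕ, g ^ k = g⁻¹ :=
          (mem_powers_iff_mem_zpowers).2 ⟨-1, by simp⟩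
        rw [← hk]
        exact M.pow_mem hg k }
  have hmem (g : G) : g ∈ H ↔
      ∃ (k : ℕ) (l : ℤ), g = b ^ (n₁ * k) * a ^ (s * geomSum r n₁ k + m₁ * l) := Iff.rfl
  -- The normal form only determines `n₁ * k` modulo `n`, so the divisibility is needed at every
  -- multiple of the period `n / n₁`.
  have hper (c : ℕ) : (m₁ : ℤ) ∣ s * geomSum r n₁ (n / n₁ * c) := by
    induction c with
    | zero => simp [geomSum]
    | succ c ih =>
      rw [mul_add, mul_one, geomSum_add, mul_add, ← mul_assoc]
      exact (ih.mul_right _).add hs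
  refine ⟨H, ⟨fun j => ?_, fun i => ?_⟩, ?_⟩
  · rw [hmem]
    constructor
    · rintro ⟨k, l, hkl⟩
      have h1 := h.eq_imp 0 (n₁ * k) j _ (by simpa using hkl)
      have h2 : n ∣ n₁ * k := (Nat.modEq_zero_iff_dvd).1 h1.1.symm
      obtain ⟨c, rfl⟩ : n / n₁ ∣ k := by
        apply Nat.dvd_of_mul_dvd_mul_left hn₁
        rwa [Nat.mul_div_cancel' hn]
      have h3 : (m₁ : ℤ) ∣ _ := (Int.natCast_dvd_natCast.2 hm).trans h1.2
      have h4 := h3.add ((hper c).add (dvd_mul_right (m₁ : ℤ) l))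
      simpa using h4
    · rintro ⟨c, rfl⟩
      exact ⟨0, c, by simp [geomSum]⟩
  · constructor
    · rintro ⟨j, k, l, hkl⟩
      have h1 := (h.eq_imp _ _ _ _ hkl).1
      exact ((Nat.ModEq.of_dvd hn h1).dvd_iff dvd_rfl).2 (dvd_mul_right _ _)
    · rintro ⟨k, rfl⟩
      exact ⟨s * geomSum r n₁ k, k, 0, by simp⟩
  · exact ⟨1, 0, by simp [geomSum]⟩

end IsZMPair

/-! ### Two counting lemmas -/

/-- With `g = gcd(d, e)`, `d = g * q`, `e = g * w` and `q`, `w` coprime, the conditions on `s = c *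
x` reduce to `q ∣ x`. This will count the residues `s` that parametrize subgroups. -/
lemma card_filter_dvd_mul {c d : ℕ} (hc : 0 < c) (hd : 0 < d) (e : ℤ) :
    ((Finset.range (c * d)).filter
      (fun s => c ∣ s ∧ ((c * d : ℕ) : ℤ) ∣ (s : ℤ) * e)).card = Int.gcd d e := by
  classical
  set g := Int.gcd d e with hg
  have hgpos : 0 < g := Int.gcd_pos_of_ne_zero_left _ (by exact_mod_cast hd.ne')
  have hgd : g ∣ d := Int.natCast_dvd_natCast.1 (Int.gcd_dvd_left ..)
  obtain ⟨q, hq⟩ := hgd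
  obtain ⟨w, hw⟩ : (g : ℤ) ∣ e := Int.gcd_dvd_right ..
  have hqpos : 0 < q := by
    rcases Nat.eq_zero_or_pos q with h | h
    · simp [h] at hq; omega
    · exact h
  have hcop : IsCoprime (q : ℤ) w := by
    rw [Int.isCoprime_iff_gcd_eq_one]
    have h1 : Int.gcd (g * q : ℤ) (g * w) = g * Int.gcd q w := by
      rw [Int.gcd_mul_left]; simp
    have h2 : (d : ℤ) = g * q := by exact_mod_cast hq
    rw [← h2, ← hw, ← hg] at h1
    exact Nat.eq_of_mul_eq_mul_left hgpos (by rw [← h1, mul_one])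
  have hset : (Finset.range (c * d)).filter
      (fun s => c ∣ s ∧ ((c * d : ℕ) : ℤ) ∣ (s : ℤ) * e) =
      (Finset.range g).image (fun t => c * q * t) := by
    ext s
    simp only [Finset.mem_filter, Finset.mem_range, Finset.mem_image]
    constructor
    · rintro ⟨hlt, ⟨x, rfl⟩, hx⟩
      have h1 : (d : ℤ) ∣ x * e := by
        push_cast at hx
        rw [mul_assoc] at hx
        exact Int.dvd_of_mul_dvd_mul_left (by exact_mod_cast hc.ne') hx
      have h2 : (q : ℤ) ∣ x * w := by
        rw [hq, hw] at h1
        push_cast at h1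
        rw [mul_left_comm] at h1
        exact Int.dvd_of_mul_dvd_mul_left (by exact_mod_cast hgpos.ne') h1
      obtain ⟨t, rfl⟩ := Int.natCast_dvd_natCast.1 (hcop.dvd_of_dvd_mul_right h2)
      refine ⟨t, ?_, by ring⟩
      have h3 : q * t < d := Nat.lt_of_mul_lt_mul_left hlt
      rw [hq, mul_comm g] at h3
      exact Nat.lt_of_mul_lt_mul_left h3
    · rintro ⟨t, ht, rfl⟩
      refine ⟨?_, ⟨q * t, by ring⟩, t * w, ?_⟩
      · rw [hq, mul_comm g, ← mul_assoc]
        exact Nat.mul_lt_mul_of_pos_left ht (by positivity)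
      · rw [hq, hw]
        push_cast
        ring
  rw [hset, Finset.card_image_of_injective _
    (fun x y hxy => Nat.eq_of_mul_eq_mul_left (by positivity) hxy), Finset.card_range]

/-- The product formula `|HK| |H ∩ K| = |H| |K|`. -/
lemma ncard_mul_mul_card_inf {G : Type*} [Group G] (H K : Subgroup G) :
    ((H : Set G) * (K : Set G)).ncard * Nat.card (H ⊓ K : Subgroup G) =
      Nat.card H * Nat.card K := by
  rw [← Nat.card_coe_set_eq, ← Nat.card_prod, ← Nat.card_prod]
  have hch (x : ((H : Set G) * (K : Set G) : Set G)) : ∃ p : H × K, (p.1 : G) * p.2 = x := by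
    obtain ⟨x, h, hh, k, hk, rfl⟩ := x
    exact ⟨(⟨h, hh⟩, ⟨k, hk⟩), rfl⟩
  choose p hp using hch
  -- For a chosen factorization `x = h * k`, all others are `(h * t, t⁻¹ * k)` with `t ∈ H ⊓ K`.
  refine Nat.card_eq_of_bijective
    (fun q => ((p q.1).1 * ⟨q.2, q.2.2.1⟩, ⟨q.2, q.2.2.2⟩⁻¹ * (p q.1).2)) ⟨?_, ?_⟩
  · rintro ⟨x, t⟩ ⟨y, u⟩ hxy
    simp only [Prod.mk.injEq, Subtype.ext_iff, Subgroup.coe_mul, Subgroup.coe_inv] at hxy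
    have h1 : x = y := by
      apply Subtype.ext
      rw [← hp x, ← hp y]
      calc _ = ((p x).1 * t : G) * ((t : G)⁻¹ * (p x).2) := by group
        _ = _ := by rw [hxy.1, hxy.2]; group
    subst h1
    have := mul_left_cancel hxy.1
    rw [Prod.mk.injEq]
    exact ⟨rfl, Subtype.ext this⟩
  · rintro ⟨h, k⟩
    let x : ((H : Set G) * (K : Set G) : Set G) := ⟨h * k, Set.mul_mem_mul h.2 k.2⟩
    have hx : ((p x).1 : G) * (p x).2 = h * k := hp x
    have h1 : ((p x).1 : G)⁻¹ * h = (p x).2 * (k : G)⁻¹ := by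
      rw [inv_mul_eq_iff_eq_mul, ← mul_assoc, hx]; group
    refine ⟨(x, ⟨((p x).1 : G)⁻¹ * h, ⟨H.mul_mem (H.inv_mem (p x).1.2) h.2, ?_⟩⟩), ?_⟩
    · change _ ∈ K
      rw [h1]
      exact K.mul_mem (p x).2.2 (K.inv_mem k.2)
    · ext
      · simp
      · simp only [Subgroup.coe_mul, Subgroup.coe_inv]
        rw [h1]; group

/-! ### Orders, factorizations and conjugacy of subgroups -/

namespace IsZMPair

variable {m n r : ℕ} {G : Type*} [Group G] {a b : G}

lemma card_mul (h : IsZMPair m n r a b) {H : Subgroup G} {m₁ n₁ : ℕ}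
    (hH : HasInvariants a b H m₁ n₁) : Nat.card H * (m₁ * n₁) = m * n := by
  obtain ⟨s, hs⟩ := (hH.2 n₁).2 dvd_rfl
  obtain ⟨u, hu⟩ := h.m_dvd hH
  obtain ⟨v, hv⟩ := h.n_dvd hH
  have hmpos := h.m_pos
  have hnpos := h.n_pos
  have hm₁ : 0 < m₁ := Nat.pos_of_dvd_of_pos ⟨u, hu⟩ hmpos
  have hn₁ : 0 < n₁ := Nat.pos_of_dvd_of_pos ⟨v, hv⟩ hnpos
  have hu0 : 0 < u := Nat.pos_of_dvd_of_pos ⟨m₁, by rw [hu, mul_comm]⟩ hmpos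
  suffices hcard : Nat.card (Fin v × Fin u) = Nat.card H by
    rw [← hcard, Nat.card_prod, Nat.card_fin, Nat.card_fin, hu, hv]
    ring
  refine Nat.card_eq_of_bijective (fun p : Fin v × Fin u =>
    (⟨b ^ (n₁ * p.1) * a ^ (s * geomSum r n₁ p.1 + m₁ * (p.2 : ℕ)), ?_⟩ : H)) ⟨?_, ?_⟩
  · rw [h.mem_iff_zpow_mem hs, hH.1]
    simp
  · rintro ⟨x, y⟩ ⟨x', y'⟩ hxy
    have h1 := h.eq_imp _ _ _ _ (Subtype.ext_iff.1 hxy)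
    have h2 : (x : ℕ) = x' := by
      have h3 := h1.1
      rw [hv] at h3
      have h4 := Nat.ModEq.mul_left_cancel' hn₁.ne' h3
      rwa [Nat.ModEq, Nat.mod_eq_of_lt x.2, Nat.mod_eq_of_lt x'.2] at h4
    have h3 := h1.2
    dsimp only at h3
    rw [h2, add_sub_add_left_eq_sub, ← mul_sub, hu, Nat.cast_mul] at h3
    have h4 := Int.dvd_of_mul_dvd_mul_left (by exact_mod_cast hm₁.ne') h3
    have h5 := (Nat.modEq_iff_dvd.2 h4)
    rw [Nat.ModEq, Nat.mod_eq_of_lt y.2, Nat.mod_eq_of_lt y'.2] at h5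
    simp only [Prod.mk.injEq, Fin.ext_iff]
    exact ⟨h2, h5.symm⟩
  · rintro ⟨g, hg⟩
    obtain ⟨i, hi, j, -, rfl⟩ := h.exists_lt g
    obtain ⟨k, rfl⟩ := (hH.2 i).1 ⟨_, hg⟩
    have h1 := hg
    rw [h.mem_iff_zpow_mem hs, hH.1] at h1
    obtain ⟨l, hl⟩ := h1
    have hu' : (0 : ℤ) < u := by exact_mod_cast hu0
    have hnn := Int.emod_nonneg l hu'.ne'
    refine ⟨(⟨k, by rw [hv] at hi; exact Nat.lt_of_mul_lt_mul_left hi⟩, ⟨(l % u).toNat, ?_⟩), ?_⟩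
    · have := Int.emod_lt_of_pos l hu'
      omega
    · apply Subtype.ext
      change b ^ (n₁ * k) * a ^ (s * geomSum r n₁ k + m₁ * ((l % u).toNat : ℤ)) = _
      congr 1
      rw [← mul_inv_eq_one, ← zpow_neg, ← zpow_add, Int.toNat_of_nonneg hnn]
      apply h.a_zpow_eq_one
      have h2 : s * geomSum r n₁ k + m₁ * (l % u) + -(j : ℤ) = m₁ * (l % u - l) := by
        rw [mul_sub, ← hl]; ring
      rw [h2, hu, Nat.cast_mul]
      exact mul_dvd_mul_left _ ((dvd_sub_comm).1 Int.dvd_self_sub_emod)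

/-- Two subgroups of `L` have product `L` iff their indices in `L` are coprime. -/
lemma mul_eq_iff (h : IsZMPair m n r a b) {H K L : Subgroup G} {m₁ n₁ m₂ n₂ m₃ n₃ : ℕ}
    (hL : HasInvariants a b L m₁ n₁) (hH : HasInvariants a b H m₂ n₂)
    (hK : HasInvariants a b K m₃ n₃) (hHL : H ≤ L) (hKL : K ≤ L) :
    (H : Set G) * (K : Set G) = L ↔ Nat.gcd m₂ m₃ = m₁ ∧ Nat.gcd n₂ n₃ = n₁ := by
  have := h.finite
  obtain ⟨m₄, n₄, hI⟩ := h.exists_hasInvariants (H ⊓ K)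
  have hm₄ : m₄ = Nat.lcm m₂ m₃ := by
    apply Nat.dvd_antisymm
    · rw [← Int.natCast_dvd_natCast, ← hI.1]
      exact ⟨(hH.1 _).2 (Int.natCast_dvd_natCast.2 (Nat.dvd_lcm_left ..)),
        (hK.1 _).2 (Int.natCast_dvd_natCast.2 (Nat.dvd_lcm_right ..))⟩
    · have h1 := (hI.1 m₄).2 dvd_rfl
      exact Nat.lcm_dvd (Int.natCast_dvd_natCast.1 ((hH.1 _).1 h1.1))
        (Int.natCast_dvd_natCast.1 ((hK.1 _).1 h1.2))
  -- Only a divisibility: unlike the `a`-part, the image of `H ⊓ K` modulo `⟨a⟩` can be smaller than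
  -- the intersection of the images.
  have hn₄ : Nat.lcm n₂ n₃ ∣ n₄ := by
    obtain ⟨j, hj⟩ := (hI.2 n₄).2 dvd_rfl
    exact Nat.lcm_dvd ((hH.2 _).1 ⟨j, hj.1⟩) ((hK.2 _).1 ⟨j, hj.2⟩)
  have hmpos := h.m_pos
  have hnpos := h.n_pos
  have cH := h.card_mul hH
  have cK := h.card_mul hK
  have cL := h.card_mul hL
  have cI := h.card_mul hI
  have hprod := ncard_mul_mul_card_inf H K
  have hmg := Nat.gcd_mul_lcm m₂ m₃
  have hng := Nat.gcd_mul_lcm n₂ n₃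
  have hm₂ := h.m_dvd hH
  have hm₃ := h.m_dvd hK
  have hn₂ := h.n_dvd hH
  have hn₃ := h.n_dvd hK
  have hm₁ := h.m_dvd hL
  have hn₁ := h.n_dvd hL
  have hn₄' := h.n_dvd hI
  have hLpos : 0 < Nat.card L := Nat.card_pos
  have hIpos : 0 < Nat.card (H ⊓ K : Subgroup G) := Nat.card_pos
  have hm₂0 := Nat.pos_of_dvd_of_pos hm₂ hmpos
  have hm₃0 := Nat.pos_of_dvd_of_pos hm₃ hmpos
  have hn₂0 := Nat.pos_of_dvd_of_pos hn₂ hnpos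
  have hn₃0 := Nat.pos_of_dvd_of_pos hn₃ hnpos
  have hm₁0 := Nat.pos_of_dvd_of_pos hm₁ hmpos
  have hn₁0 := Nat.pos_of_dvd_of_pos hn₁ hnpos
  have hn₄0 := Nat.pos_of_dvd_of_pos hn₄' hnpos
  have hlm : 0 < Nat.lcm m₂ m₃ := Nat.lcm_pos hm₂0 hm₃0
  have hln : 0 < Nat.lcm n₂ n₃ := Nat.lcm_pos hn₂0 hn₃0
  -- the ratio of `|HK|` and `|L|`
  have key : ((H : Set G) * (K : Set G)).ncard * ((Nat.gcd m₂ m₃ * Nat.lcm m₂ m₃) * (n₂ * n₃)) =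
      Nat.card L * ((m₁ * Nat.lcm m₂ m₃) * (n₁ * n₄)) := by
    subst hm₄
    rw [hmg]
    apply Nat.eq_of_mul_eq_mul_right hIpos
    calc _ = (((H : Set G) * (K : Set G)).ncard * Nat.card (H ⊓ K : Subgroup G)) *
          ((m₂ * m₃) * (n₂ * n₃)) := by ring
      _ = (Nat.card H * (m₂ * n₂)) * (Nat.card K * (m₃ * n₃)) := by rw [hprod]; ring
      _ = (Nat.card L * (m₁ * n₁)) * (Nat.card (H ⊓ K : Subgroup G) * (m₂.lcm m₃ * n₄)) := by
        rw [cH, cK, cL, cI]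
      _ = _ := by ring
  constructor
  · intro heq
    have hn : Nat.gcd n₂ n₃ = n₁ := by
      apply Nat.dvd_antisymm
      · obtain ⟨s, hs⟩ := (hL.2 n₁).2 dvd_rfl
        have hs' : b ^ n₁ * a ^ s ∈ (H : Set G) * (K : Set G) := heq ▸ hs
        obtain ⟨x, hx, y, hy, hxy⟩ := hs'
        obtain ⟨i, j, rfl⟩ := h.exists_eq x
        obtain ⟨i', j', rfl⟩ := h.exists_eq y
        have h1 := (hH.2 i).1 ⟨j, hx⟩
        have h2 := (hK.2 i').1 ⟨j', hy⟩
        dsimp only at hxy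
        rw [h.mul_eq] at hxy
        have h3 := (h.eq_imp _ _ _ _ hxy).1
        refine ((h3.of_dvd ((Nat.gcd_dvd_left n₂ n₃).trans hn₂)).dvd_iff dvd_rfl).1 ?_
        exact ((Nat.gcd_dvd_left ..).trans h1).add ((Nat.gcd_dvd_right ..).trans h2)
      · apply Nat.dvd_gcd
        · obtain ⟨s, hs⟩ := (hH.2 n₂).2 dvd_rfl
          exact (hL.2 _).1 ⟨s, hHL hs⟩
        · obtain ⟨s, hs⟩ := (hK.2 n₃).2 dvd_rfl
          exact (hL.2 _).1 ⟨s, hKL hs⟩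
    refine ⟨?_, hn⟩
    rw [heq, ← Nat.card_coe_set_eq] at key
    have key' := Nat.eq_of_mul_eq_mul_left hLpos key
    -- Since `m` and `n` are coprime, this equality splits into its `m`-part and its `n`-part.
    have e1 : Nat.gcd m₂ m₃ * (n₂ * n₃) = m₁ * (n₁ * n₄) := by
      apply Nat.eq_of_mul_eq_mul_right hlm
      linarith
    have cop {x y : ℕ} (hx : x ∣ m) (hy : y ∣ n) : Nat.Coprime x y :=
      Nat.Coprime.of_dvd hx hy h.coprime
    have hg : Nat.gcd m₂ m₃ ∣ m := (Nat.gcd_dvd_left ..).trans hm₂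
    apply Nat.dvd_antisymm
    · exact ((cop hg hn₁).mul_right (cop hg hn₄')).dvd_of_dvd_mul_right ⟨_, e1.symm⟩
    · exact ((cop hm₁ hn₂).mul_right (cop hm₁ hn₃)).dvd_of_dvd_mul_right ⟨_, e1⟩
  · rintro ⟨hm, hn⟩
    apply Set.eq_of_subset_of_ncard_le
    · rintro _ ⟨x, hx, y, hy, rfl⟩
      exact L.mul_mem (hHL hx) (hKL hy)
    · rw [← Nat.card_coe_set_eq]
      change Nat.card L ≤ _
      -- With both gcds as required, `n₄ ≥ lcm(n₂, n₃)` makes `|HK| ≥ |L|` in `key`.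
      have hle := Nat.le_of_dvd hn₄0 hn₄
      rw [hm, ← hng, hn] at key
      by_contra! hlt
      have hpos : 0 < m₁ * m₂.lcm m₃ * (n₁ * n₄) := by positivity
      have : m₁ * m₂.lcm m₃ * (n₁ * n₂.lcm n₃) ≤ m₁ * m₂.lcm m₃ * (n₁ * n₄) := by gcongr
      have h1 := Nat.mul_le_mul_left ((H : Set G) * (K : Set G)).ncard this
      rw [key] at h1
      exact absurd (Nat.le_of_mul_le_mul_right h1 hpos) hlt.not_ge
    · exact Set.toFinite _

lemma exists_lt_mem (h : IsZMPair m n r a b) {H : Subgroup G} {m₁ n₁ : ℕ}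
    (hH : HasInvariants a b H m₁ n₁) : ∃ s < m₁, b ^ n₁ * a ^ (s : ℤ) ∈ H := by
  obtain ⟨s, hs⟩ := (hH.2 n₁).2 dvd_rfl
  have hm₁ : (0 : ℤ) < m₁ := by
    exact_mod_cast Nat.pos_of_dvd_of_pos (h.m_dvd hH) h.m_pos
  have h1 := Int.emod_nonneg s hm₁.ne'
  have h2 := Int.emod_lt_of_pos s hm₁
  refine ⟨(s % m₁).toNat, by omega, ?_⟩
  rw [h.mem_iff_dvd_sub hH hs, Int.toNat_of_nonneg h1]
  exact (dvd_sub_comm).1 Int.dvd_self_sub_emod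

/-- The number of subgroups with given invariants in `⟨a ^ m₁, b ^ n₁⟩`. -/
lemma ncard_subgroups (h : IsZMPair m n r a b) {L : Subgroup G} {m₁ n₁ m₂ n₂ : ℕ}
    (hL : HasInvariants a b L m₁ n₁) (hb : b ^ n₁ ∈ L) (hm₁₂ : m₁ ∣ m₂) (hm₂ : m₂ ∣ m)
    (hn₁₂ : n₁ ∣ n₂) (hn₂ : n₂ ∣ n) :
    {H : Subgroup G | H ≤ L ∧ HasInvariants a b H m₂ n₂}.ncard =
      Int.gcd (m₂ / m₁ : ℕ) (geomSum r n₂ (n / n₂)) := by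
  obtain ⟨d, rfl⟩ := hm₁₂
  have hm₁0 := Nat.pos_of_dvd_of_pos ((dvd_mul_right m₁ d).trans hm₂) h.m_pos
  have hd0 := Nat.pos_of_dvd_of_pos ((dvd_mul_left d m₁).trans hm₂) h.m_pos
  have hbL (s : ℤ) : b ^ n₂ * a ^ s ∈ L ↔ (m₁ : ℤ) ∣ s := by
    obtain ⟨k, rfl⟩ := hn₁₂
    have := h.mem_iff_zpow_mem (H := L) (i := n₁) (s := 0) (by simpa using hb) k s
    rw [this, hL.1]
    simp
  rw [Nat.mul_div_cancel_left _ hm₁0, ← card_filter_dvd_mul hm₁0 hd0, ← Set.ncard_coe_finset]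
  have hex (H : Subgroup G) (hH : H ∈ {H : Subgroup G | H ≤ L ∧ HasInvariants a b H (m₁ * d) n₂}) :
      ∃ s < m₁ * d, b ^ n₂ * a ^ (s : ℤ) ∈ H := h.exists_lt_mem hH.2
  -- `σ H` is the residue `s` of `H`. It determines `H`, and `H ≤ L` amounts to `m₁ ∣ s` because `b
  -- ^ n₁ ∈ L`.
  choose! σ hlt hσ using hex
  refine Set.ncard_congr (fun H _ => σ H) ?_ ?_ ?_
  · intro H hH
    simp only [Finset.coe_filter, Finset.mem_range]
    refine ⟨hlt H hH, ?_, h.dvd_mul_geomSum hH.2 (hσ H hH)⟩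
    exact Int.natCast_dvd_natCast.1 ((hbL _).1 (hH.1 (hσ H hH)))
  · intro H K hH hK heq
    have h1 := hσ H hH
    have h2 := hσ K hK
    rw [← heq] at h2
    apply le_antisymm
    · exact (h.le_iff hH.2 h1).2 ⟨(hK.2.1 _).2 dvd_rfl, h2⟩
    · exact (h.le_iff hK.2 h2).2 ⟨(hH.2.1 _).2 dvd_rfl, h1⟩
  · intro s hs
    simp only [Finset.coe_filter, Finset.mem_range] at hs
    obtain ⟨hs1, hs2, hs3⟩ := hs
    obtain ⟨H, hH, hsH⟩ := h.exists_subgroup hm₂ hn₂ hs3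
    have hmem : H ∈ {H : Subgroup G | H ≤ L ∧ HasInvariants a b H (m₁ * d) n₂} := by
      refine ⟨(h.le_iff hH hsH).2 ⟨?_, ?_⟩, hH⟩
      · rw [hL.1]; exact_mod_cast dvd_mul_right m₁ d
      · rw [hbL]; exact_mod_cast hs2
    refine ⟨H, hmem, ?_⟩
    have h1 := (h.mem_iff_dvd_sub hH hsH _).1 (hσ H hmem)
    have h2 := Nat.modEq_iff_dvd.2 h1
    rw [Nat.ModEq, Nat.mod_eq_of_lt hs1, Nat.mod_eq_of_lt (hlt H hmem)] at h2
    exact h2.symm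

/-- Every subgroup is conjugate to one containing the power `b ^ n₁`. -/
lemma exists_conj (h : IsZMPair m n r a b) {L : Subgroup G} {m₁ n₁ : ℕ}
    (hL : HasInvariants a b L m₁ n₁) : ∃ g : G,
      HasInvariants a b (L.map (MulAut.conj g).toMonoidHom) m₁ n₁ ∧
      b ^ n₁ ∈ L.map (MulAut.conj g).toMonoidHom := by
  obtain ⟨s, hs⟩ := (hL.2 n₁).2 dvd_rfl
  -- Conjugation by powers of `a` shifts `s` by multiples of `r ^ n₁ - 1`, so `s` must be such a
  -- multiple modulo `m₁`.
  obtain ⟨x, y, hxy⟩ : ∃ x y : ℤ, s = m₁ * x + ((r : ℤ) ^ n₁ - 1) * y := by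
    have hdvd : (Int.gcd m₁ ((r : ℤ) ^ n₁ - 1) : ℤ) ∣ s := by
      set g := Int.gcd m₁ ((r : ℤ) ^ n₁ - 1)
      have hgm : (g : ℤ) ∣ m₁ := Int.gcd_dvd_left ..
      have hgr : (g : ℤ) ∣ (r : ℤ) ^ n₁ - 1 := Int.gcd_dvd_right ..
      have h1 := hgm.trans (h.dvd_mul_geomSum hL hs)
      -- Modulo `g` each term of the sum is `1`, so the sum is `n / n₁`, which is prime to `m` and
      -- hence to `g`; thus `g ∣ s`.
      have h2 : (g : ℤ) ∣ geomSum r n₁ (n / n₁) - (n / n₁ : ℕ) := by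
        have : geomSum r n₁ (n / n₁) - (n / n₁ : ℕ) =
            ∑ t ∈ Finset.range (n / n₁), (((r : ℤ) ^ n₁) ^ t - 1) := by
          simp [geomSum]
        rw [this]
        exact Finset.dvd_sum fun t _ => hgr.trans (by simpa using sub_dvd_pow_sub_pow ((r : ℤ) ^ n₁) 1 t)
      have h3 : (g : ℤ) ∣ s * (n / n₁ : ℕ) := by
        have := h1.sub (h2.mul_left s)
        rwa [mul_sub, sub_sub_cancel] at this
      have h4 : IsCoprime (g : ℤ) (n / n₁ : ℕ) := by
        rw [Nat.isCoprime_iff_coprime]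
        exact Nat.Coprime.of_dvd ((Int.natCast_dvd_natCast.1 hgm).trans (h.m_dvd hL))
          (Nat.div_dvd_of_dvd (h.n_dvd hL)) h.coprime
      exact h4.dvd_of_dvd_mul_right h3
    obtain ⟨c, hc⟩ := hdvd
    refine ⟨Int.gcdA m₁ ((r : ℤ) ^ n₁ - 1) * c, Int.gcdB m₁ ((r : ℤ) ^ n₁ - 1) * c, ?_⟩
    rw [hc, Int.gcd_eq_gcd_ab]
    ring
  have hmem (g z : G) : z ∈ L.map (MulAut.conj g).toMonoidHom ↔ g⁻¹ * z * g ∈ L := by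
    constructor
    · rintro ⟨w, hw, rfl⟩
      simpa [mul_assoc] using hw
    · intro hz
      exact ⟨_, hz, by simp [mul_assoc]⟩
  have hconj (k : ℤ) (i : ℕ) (j : ℤ) :
      (a ^ k)⁻¹ * (b ^ i * a ^ j) * a ^ k = b ^ i * a ^ (j + (k - k * (r : ℤ) ^ i)) := by
    rw [← zpow_neg, ← mul_assoc, h.zpow_mul_pow, mul_assoc, mul_assoc, ← zpow_add, ← zpow_add]
    congr 2
    ring
  have hinv (k : ℤ) : HasInvariants a b (L.map (MulAut.conj (a ^ k)).toMonoidHom) m₁ n₁ := by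
    constructor
    · intro j
      rw [hmem, ← zpow_neg, ← zpow_add, ← zpow_add, ← hL.1]
      congr! 2
      ring
    · intro i
      rw [← hL.2]
      constructor
      · rintro ⟨j, hj⟩
        rw [hmem, hconj] at hj
        exact ⟨_, hj⟩
      · rintro ⟨j, hj⟩
        refine ⟨j - (k - k * (r : ℤ) ^ i), ?_⟩
        rwa [hmem, hconj, sub_add_cancel]
  refine ⟨a ^ (-y), hinv _, ?_⟩
  have h1 : b ^ n₁ = b ^ n₁ * a ^ (0 : ℤ) := by simp
  rw [hmem, h1, hconj, h.mem_iff_dvd_sub hL hs, hxy]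
  exact ⟨-x, by ring⟩

end IsZMPair

/-! ### The normal form in the presented group -/

lemma exists_genB_pow_mul_genA_zpow {m n r : ℕ} (hn : 0 < n) (g : ZM m n r) :
    ∃ (i : ℕ) (j : ℤ), g = genB m n r ^ i * genA m n r ^ j := by
  have hb : genB m n r ^ n = 1 := PresentedGroup.one_of_mem (by simp [relators])
  have hcomm : genA m n r * genB m n r = genB m n r * genA m n r ^ r := by
    have : (genB m n r)⁻¹ * genA m n r * genB m n r * (genA m n r ^ r)⁻¹ = 1 :=
      PresentedGroup.one_of_mem (by simp [relators])
    rw [mul_inv_eq_one, mul_assoc, inv_mul_eq_iff_eq_mul] at this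
    exact this
  have hmove := zpow_mul_pow_of_comm hcomm
  set a := genA m n r with ha
  set b := genB m n r with hbdef
  let S : Subgroup (ZM m n r) :=
    { carrier := {g | ∃ (i : ℕ) (j : ℤ), g = b ^ i * a ^ j}
      one_mem' := ⟨0, 0, by simp⟩
      mul_mem' := by
        rintro _ _ ⟨i, j, rfl⟩ ⟨k, l, rfl⟩
        refine ⟨i + k, j * (r : ℤ) ^ k + l, ?_⟩
        rw [mul_assoc, ← mul_assoc (a ^ j), hmove, pow_add, zpow_add]
        group
      inv_mem' := by
        rintro _ ⟨i, j, rfl⟩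
        -- Exponents of `b` are natural numbers; `i * (n - 1)` represents `-i` modulo `n`.
        refine ⟨i * (n - 1), -j * (r : ℤ) ^ (i * (n - 1)), ?_⟩
        rw [← hmove, mul_inv_rev, ← zpow_neg]
        congr 1
        rw [inv_eq_iff_mul_eq_one, ← pow_add, show i + i * (n - 1) = n * i by
          obtain ⟨k, rfl⟩ := Nat.exists_eq_add_of_lt hn; simp; ring, pow_mul, hb, one_pow] }
  refine PresentedGroup.generated_by _ S (fun x => ?_) g
  fin_cases x
  · exact ⟨0, 1, by simp [ha, genA]⟩
  · exact ⟨1, 0, by simp [hbdef, genB]⟩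

/-- The generators of `ZM(m, n, r)` have a unique normal form; uniqueness is seen in the group
`Perm (ZMod m) × ZMod n`, with `a` acting as `x ↦ x + 1` and `b` as `x ↦ r⁻¹ x`. -/
lemma IsZMTriple.isZMPair {m n r : ℕ} (h : IsZMTriple m n r) :
    IsZMPair m n r (genA m n r) (genB m n r) := by
  have ha : genA m n r ^ m = 1 := PresentedGroup.one_of_mem (by simp [relators])
  have hb : genB m n r ^ n = 1 := PresentedGroup.one_of_mem (by simp [relators])
  refine ⟨h.m_pos, h.n_pos, h.coprime, ha, hb, ?_, ?_, exists_genB_pow_mul_genA_zpow h.n_pos⟩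
  · have : (genB m n r)⁻¹ * genA m n r * genB m n r * (genA m n r ^ r)⁻¹ = 1 :=
      PresentedGroup.one_of_mem (by simp [relators])
    rw [mul_inv_eq_one, mul_assoc, inv_mul_eq_iff_eq_mul] at this
    exact this
  · have hr : (r : ZMod m) ^ n = 1 := by
      have := (ZMod.natCast_eq_natCast_iff _ _ _).2 h.pow_modEq
      exact_mod_cast this
    let u : (ZMod m)ˣ := Units.ofPowEqOne (r : ZMod m) n hr h.n_pos.ne'
    have hu : u ^ n = 1 := Units.ext (by simp [u])
    let α : Equiv.Perm (ZMod m) := Equiv.addRight 1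
    -- The inverse makes `β⁻¹ * α * β` the map `y ↦ u * (u⁻¹ * y + 1) = y + r`, which is `α ^ r`.
    let β : Equiv.Perm (ZMod m) := (MulAction.toPermHom (ZMod m)ˣ (ZMod m) u)⁻¹
    have hα (j : ℤ) : α ^ j = Equiv.addRight (j : ZMod m) := by
      induction j with
      | zero => ext y; simp
      | succ j ih => rw [zpow_add_one, ih]; ext y; simp [α, add_assoc, add_comm (1 : ZMod m)]
      | pred j ih =>
        rw [zpow_sub_one, ih, mul_inv_eq_iff_eq_mul]
        ext y
        simp [α, add_assoc]
    have hF : ∀ x ∈ relators m n r, FreeGroup.lift ![α, β] x = 1 := by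
      rintro x (rfl | rfl | rfl)
      · rw [map_pow, FreeGroup.lift_apply_of, Matrix.cons_val_zero, ← zpow_natCast, hα]
        ext y
        simp
      · rw [map_pow, FreeGroup.lift_apply_of, Matrix.cons_val_one, Matrix.cons_val_fin_one,
          inv_pow, ← map_pow, hu, map_one, inv_one]
      · rw [map_mul, map_inv, mul_inv_eq_one, map_mul, map_mul, map_inv, map_pow]
        simp only [FreeGroup.lift_apply_of, Matrix.cons_val_zero, Matrix.cons_val_one,
          Matrix.cons_val_fin_one]
        rw [← zpow_natCast, hα]
        ext y
        have h1 : u • (u⁻¹ • y + 1) = y + (r : ZMod m) := by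
          rw [smul_add, smul_inv_smul, Units.smul_def]
          simp [u]
        simpa [α, β] using h1
    -- The order of `u` may be smaller than `n`, so the `b`-exponent is read off in `ZMod n`
    -- instead.
    have hF' : ∀ x ∈ relators m n r,
        FreeGroup.lift ![1, Multiplicative.ofAdd (1 : ZMod n)] x = 1 := by
      rintro x (rfl | rfl | rfl) <;> simp [← ofAdd_nsmul]
    let φ := PresentedGroup.toGroup hF
    let ψ := PresentedGroup.toGroup hF'
    have hφ : φ (genA m n r) = α := PresentedGroup.toGroup.of hF
    have hψa : ψ (genA m n r) = 1 := PresentedGroup.toGroup.of hF'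
    have hψb : ψ (genB m n r) = Multiplicative.ofAdd 1 := PresentedGroup.toGroup.of hF'
    intro i k j l heq
    have h1 : i ≡ k [MOD n] := by
      have := congrArg ψ heq
      simp only [map_mul, map_pow, map_zpow, hψa, hψb,
        one_zpow, mul_one, ← ofAdd_nsmul, EmbeddingLike.apply_eq_iff_eq, nsmul_one] at this
      exact (ZMod.natCast_eq_natCast_iff _ _ _).1 this
    refine ⟨h1, ?_⟩
    rw [pow_eq_pow_of_modEq h1 hb, mul_right_inj] at heq
    have := congrArg (fun g => φ g 0) heq
    simp only [map_zpow, hφ, hα, Equiv.coe_addRight, zero_add] at this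
    exact (dvd_sub_comm).1 ((ZMod.intCast_eq_intCast_iff_dvd_sub _ _ _).1 this)

lemma IsZMTriple.eq_one_of_lt_two {m n r : ℕ} (h : IsZMTriple m n r) (hr : r < 2) : m = 1 := by
  interval_cases r
  · have := h.pow_modEq
    rw [zero_pow h.n_pos.ne'] at this
    exact Nat.dvd_one.1 ((Nat.modEq_iff_dvd' zero_le_one).1 this)
  · simpa [isCoprime_zero_right, Int.isUnit_iff_natAbs_eq] using h.coprime_sub_one

/-- For `r ≥ 2` the quotient is the geometric sum itself. For `r < 2` the two may differ, but `m =
1` forces `d = 1`. -/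
lemma IsZMTriple.gcd_powQuot {m n r d n₁ : ℕ} (h : IsZMTriple m n r) (hd : d ∣ m) (hn : n₁ ∣ n) :
    Int.gcd d (geomSum r n₁ (n / n₁)) = Nat.gcd d (powQuot n r n₁) := by
  rcases lt_or_ge r 2 with hr | hr
  · rw [h.eq_one_of_lt_two hr, Nat.dvd_one] at hd
    subst hd
    simp
  · have hn₁ : n₁ ≠ 0 := (Nat.pos_of_dvd_of_pos hn h.n_pos).ne'
    have h2 : 2 ≤ r ^ n₁ := hr.trans (Nat.le_self_pow hn₁ r)
    have h3 : geomSum r n₁ (n / n₁) = (powQuot n r n₁ : ℕ) := by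
      rw [powQuot]
      nth_rw 2 [← Nat.mul_div_cancel' hn]
      rw [pow_mul, ← Nat.geomSum_eq h2]
      simp [geomSum]
    rw [h3, Int.gcd_natCast_natCast]

lemma HasInvariants.eq_H {m n r m₁ n₁ : ℕ} (h : IsZMTriple m n r) {L : Subgroup (ZM m n r)}
    (hL : HasInvariants (genA m n r) (genB m n r) L m₁ n₁) (hb : genB m n r ^ n₁ ∈ L) :
    L = H m n r m₁ n₁ 0 := by
  apply le_antisymm
  · refine (h.isZMPair.le_iff (s := 0) hL (by simpa using hb)).2 ⟨?_, ?_⟩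
    · exact Subgroup.subset_closure (by simp)
    · exact Subgroup.subset_closure (by simp)
  · rw [H, Subgroup.closure_le]
    rintro x (rfl | rfl)
    · have := (hL.1 m₁).2 dvd_rfl
      simpa using this
    · simpa using hb

/-! ### Factorizations and permuting subgroups -/

lemma factorizationNumber_congr {G G' : Type*} [Group G] [Group G'] (e : G ≃* G') :
    factorizationNumber G = factorizationNumber G' := by
  refine Nat.card_congr (Equiv.subtypeEquiv
    (e.mapSubgroup.toEquiv.prodCongr e.mapSubgroup.toEquiv) fun p => ?_)
  change _ ↔ (((p.1.map e.toMonoidHom : Subgroup G') : Set G') *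
    ((p.2.map e.toMonoidHom : Subgroup G') : Set G')) = Set.univ
  rw [Subgroup.coe_map, Subgroup.coe_map, ← Set.image_mul]
  change _ ↔ e '' _ = _
  rw [← Set.image_univ_of_surjective e.surjective, e.injective.image_injective.eq_iff]

/-- Factorizations of the group `L` correspond to pairs of subgroups of `G` with product `L`. -/
lemma factorizationNumber_subgroup {G : Type*} [Group G] (L : Subgroup G) :
    factorizationNumber L =
      Nat.card {p : Subgroup G × Subgroup G // (p.1 : Set G) * (p.2 : Set G) = L} := by
  have himg (H K : Subgroup L) : ((H.map L.subtype : Subgroup G) : Set G) *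
      ((K.map L.subtype : Subgroup G) : Set G) = L.subtype '' ((H : Set L) * (K : Set L)) := by
    rw [Subgroup.coe_map, Subgroup.coe_map, ← Set.image_mul]
  have huniv : L.subtype '' Set.univ = L := by simp
  have hinj : Function.Injective L.subtype := L.subtype_injective
  refine Nat.card_eq_of_bijective (fun p => ⟨(p.1.1.map L.subtype, p.1.2.map L.subtype), ?_⟩)
    ⟨?_, ?_⟩
  · rw [himg, p.2, huniv]
  · rintro ⟨⟨H, K⟩, hp⟩ ⟨⟨H', K'⟩, hp'⟩ heq
    simp only [Subtype.mk.injEq, Prod.mk.injEq] at heq ⊢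
    exact ⟨Subgroup.map_injective hinj heq.1, Subgroup.map_injective hinj heq.2⟩
  · rintro ⟨⟨H, K⟩, hp⟩
    have hH : H ≤ L := fun x hx => by
      change x ∈ (L : Set G)
      rw [← hp]
      exact ⟨x, hx, 1, K.one_mem, mul_one x⟩
    have hK : K ≤ L := fun x hx => by
      change x ∈ (L : Set G)
      rw [← hp]
      exact ⟨1, H.one_mem, x, hx, one_mul x⟩
    have eH : (H.subgroupOf L).map L.subtype = H := by simpa using hH
    have eK : (K.subgroupOf L).map L.subtype = K := by simpa using hK
    refine ⟨⟨(H.subgroupOf L, K.subgroupOf L), ?_⟩, ?_⟩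
    · apply hinj.image_injective
      rw [← himg, eH, eK, hp, huniv]
    · simp only [eH, eK]

/-- `HK` is a subgroup iff `HK = KH`. -/
lemma mul_eq_coe_iff {G : Type*} [Group G] (H K L : Subgroup G) :
    (H : Set G) * (K : Set G) = L ↔
      (H : Set G) * (K : Set G) = (K : Set G) * (H : Set G) ∧ H ⊔ K = L := by
  constructor
  · intro h
    constructor
    -- Inversion turns `HK` into `KH` and fixes `L`.
    · have := congrArg (·⁻¹) h
      simp only [mul_inv_rev, inv_coe_set] at this
      rw [h, this]
    · rw [Subgroup.sup_eq_closure_mul, h, Subgroup.closure_eq]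
  · rintro ⟨h, rfl⟩
    apply Set.Subset.antisymm
    · rintro _ ⟨x, hx, y, hy, rfl⟩
      exact (H ⊔ K).mul_mem (le_sup_left (a := H) hx) (le_sup_right (a := H) hy)
    · let M : Subgroup G :=
        { carrier := (H : Set G) * (K : Set G)
          one_mem' := ⟨1, H.one_mem, 1, K.one_mem, mul_one 1⟩
          mul_mem' := by
            intro x y hx hy
            have := Set.mul_mem_mul hx hy
            rwa [mul_assoc, ← mul_assoc (K : Set G), ← h, mul_assoc (H : Set G), coe_mul_coe,
              ← mul_assoc, coe_mul_coe] at this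
          inv_mem' := by
            intro x hx
            have := Set.inv_mem_inv.2 hx
            rwa [mul_inv_rev, inv_coe_set, inv_coe_set, ← h] at this }
      have h1 : H ≤ M := fun x hx => ⟨x, hx, 1, K.one_mem, mul_one x⟩
      have h2 : K ≤ M := fun x hx => ⟨1, H.one_mem, x, hx, one_mul x⟩
      exact fun x hx => (sup_le h1 h2) hx

/-! ### The formulas for `f` and for `sd` -/

namespace IsZMTriple

variable {m n r : ℕ}

lemma factorizationNumber_eq_f (h : IsZMTriple m n r) {L : Subgroup (ZM m n r)} {m₁ n₁ : ℕ}
    (hL : HasInvariants (genA m n r) (genB m n r) L m₁ n₁) :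
    factorizationNumber L = f m n r m₁ n₁ := by
  obtain ⟨g, hg, hb⟩ := h.isZMPair.exists_conj hL
  rw [f, ← hg.eq_H h hb]
  exact factorizationNumber_congr ((MulAut.conj g).subgroupMap L)

lemma ncard_le_H (h : IsZMTriple m n r) {L : Subgroup (ZM m n r)} {m₁ n₁ m₂ n₂ : ℕ}
    (hL : HasInvariants (genA m n r) (genB m n r) L m₁ n₁) (hb : genB m n r ^ n₁ ∈ L)
    (hm₁₂ : m₁ ∣ m₂) (hm₂ : m₂ ∣ m) (hn₁₂ : n₁ ∣ n₂) (hn₂ : n₂ ∣ n) :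
    {K : Subgroup (ZM m n r) | K ≤ L ∧ HasInvariants (genA m n r) (genB m n r) K m₂ n₂}.ncard =
      Nat.gcd (m₂ / m₁) (powQuot n r n₂) := by
  rw [h.isZMPair.ncard_subgroups hL hb hm₁₂ hm₂ hn₁₂ hn₂,
    h.gcd_powQuot ((Nat.div_dvd_of_dvd hm₁₂).trans hm₂) hn₂]

/-- Sort the factorizations of a subgroup `L` containing `b ^ n₁` by the invariants of both factors.
By `mul_eq_iff`, each fibre over admissible invariants is a full product of two sets of subgroups of
`L`. -/
lemma f_eq (h : IsZMTriple m n r) {m₁ n₁ : ℕ} (hm₁ : m₁ ∣ m) (hn₁ : n₁ ∣ n) :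
    f m n r m₁ n₁ =
      ∑ p ∈ (m.divisors ×ˢ m.divisors).filter (fun p => Nat.gcd p.1 p.2 = m₁),
        ∑ q ∈ (n.divisors ×ˢ n.divisors).filter (fun q => Nat.gcd q.1 q.2 = n₁),
          Nat.gcd (p.1 / m₁) (powQuot n r q.1) * Nat.gcd (p.2 / m₁) (powQuot n r q.2) := by
  classical
  have hp := h.isZMPair
  have := hp.finite
  have := Fintype.ofFinite (Subgroup (ZM m n r))
  obtain ⟨L, hL, hbL⟩ := hp.exists_subgroup (s := 0) hm₁ hn₁ (by simp)
  rw [zpow_zero, mul_one] at hbL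
  choose μ ν hinv using hp.exists_hasInvariants
  have hiff (K : Subgroup (ZM m n r)) (x y : ℕ) :
      HasInvariants (genA m n r) (genB m n r) K x y ↔ μ K = x ∧ ν K = y :=
    ⟨fun hK => (hinv K).unique hK, by rintro ⟨rfl, rfl⟩; exact hinv K⟩
  rw [← h.factorizationNumber_eq_f hL, factorizationNumber_subgroup, Nat.card_eq_fintype_card,
    Fintype.card_subtype, ← Finset.sum_product',
    Finset.card_eq_sum_card_fiberwise (f := fun p => ((μ p.1, μ p.2), (ν p.1, ν p.2)))
      (t := (m.divisors ×ˢ m.divisors).filter (fun p => Nat.gcd p.1 p.2 = m₁) ×ˢ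
        (n.divisors ×ˢ n.divisors).filter (fun q => Nat.gcd q.1 q.2 = n₁))]
  · refine Finset.sum_congr rfl ?_
    rintro ⟨⟨m₂, m₃⟩, ⟨n₂, n₃⟩⟩ hx
    simp only [Finset.mem_product, Finset.mem_filter, Nat.mem_divisors] at hx
    obtain ⟨⟨⟨⟨hm₂, -⟩, ⟨hm₃, -⟩⟩, hgm⟩, ⟨⟨⟨hn₂, -⟩, ⟨hn₃, -⟩⟩, hgn⟩⟩ := hx
    rw [← h.ncard_le_H hL hbL (hgm ▸ Nat.gcd_dvd_left ..) hm₂ (hgn ▸ Nat.gcd_dvd_left ..) hn₂,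
      ← h.ncard_le_H hL hbL (hgm ▸ Nat.gcd_dvd_right ..) hm₃ (hgn ▸ Nat.gcd_dvd_right ..) hn₃,
      ← Set.ncard_prod, ← Set.ncard_coe_finset]
    congr 1
    ext ⟨K₂, K₃⟩
    simp only [Finset.coe_filter, Finset.mem_filter, Finset.mem_univ, true_and, Set.mem_prod,
      Prod.mk.injEq]
    constructor
    · rintro ⟨heq, ⟨h₂, h₃⟩, h₂', h₃'⟩
      have hsup := ((mul_eq_coe_iff _ _ _).1 heq).2
      exact ⟨⟨hsup ▸ le_sup_left, (hiff ..).2 ⟨h₂, h₂'⟩⟩,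
        ⟨hsup ▸ le_sup_right, (hiff ..).2 ⟨h₃, h₃'⟩⟩⟩
    · rintro ⟨⟨hle₂, hi₂⟩, ⟨hle₃, hi₃⟩⟩
      have h₂ := (hiff ..).1 hi₂
      have h₃ := (hiff ..).1 hi₃
      exact ⟨(hp.mul_eq_iff hL hi₂ hi₃ hle₂ hle₃).2 ⟨hgm, hgn⟩, ⟨h₂.1, h₃.1⟩, h₂.2, h₃.2⟩
  · rintro ⟨K₂, K₃⟩ heq
    simp only [Finset.coe_filter, Finset.mem_univ, true_and] at heq
    have hsup := ((mul_eq_coe_iff _ _ _).1 heq).2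
    have hg := (hp.mul_eq_iff hL (hinv K₂) (hinv K₃) (hsup ▸ le_sup_left)
      (hsup ▸ le_sup_right)).1 heq
    simp only [Finset.coe_product, Set.mem_prod, Finset.mem_coe, Finset.mem_filter,
      Finset.mem_product, Nat.mem_divisors]
    exact ⟨⟨⟨⟨hp.m_dvd (hinv K₂), hp.m_pos.ne'⟩, hp.m_dvd (hinv K₃), hp.m_pos.ne'⟩, hg.1⟩,
      ⟨⟨hp.n_dvd (hinv K₂), hp.n_pos.ne'⟩, hp.n_dvd (hinv K₃), hp.n_pos.ne'⟩, hg.2⟩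

/-- Sums over the subgroups of `ZM(m, n, r)` of a function of the invariants. -/
lemma sum_subgroups (h : IsZMTriple m n r) [Fintype (Subgroup (ZM m n r))]
    (φ : Subgroup (ZM m n r) → ℕ) (ψ : ℕ → ℕ → ℕ)
    (hφ : ∀ L m₁ n₁, HasInvariants (genA m n r) (genB m n r) L m₁ n₁ → φ L = ψ m₁ n₁) :
    ∑ L, φ L =
      ∑ m₁ ∈ m.divisors, ∑ n₁ ∈ n.divisors, Nat.gcd m₁ (powQuot n r n₁) * ψ m₁ n₁ := by
  classical
  have hp := h.isZMPair
  choose μ ν hinv using hp.exists_hasInvariants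
  rw [← Finset.sum_product', ← Finset.sum_fiberwise_of_maps_to (g := fun L => (μ L, ν L))
    (t := m.divisors ×ˢ n.divisors)]
  · refine Finset.sum_congr rfl ?_
    rintro ⟨m₁, n₁⟩ hx
    simp only [Finset.mem_product, Nat.mem_divisors] at hx
    have hcard := h.ncard_le_H (hasInvariants_top _ _) (Subgroup.mem_top _) (one_dvd _) hx.1.1
      (one_dvd _) hx.2.1
    rw [Nat.div_one] at hcard
    rw [← hcard, ← smul_eq_mul]
    have hset : {K : Subgroup (ZM m n r) | K ≤ ⊤ ∧
        HasInvariants (genA m n r) (genB m n r) K m₁ n₁} =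
        (Finset.univ.filter fun L => (μ L, ν L) = (m₁, n₁) : Finset (Subgroup (ZM m n r))) := by
      ext K
      simp only [le_top, true_and, Finset.coe_filter, Finset.mem_univ, Prod.mk.injEq]
      exact ⟨fun hK => (hinv K).unique hK, by rintro ⟨rfl, rfl⟩; exact hinv K⟩
    rw [hset, Set.ncard_coe_finset, ← Finset.sum_const]
    refine Finset.sum_congr rfl fun L hL => hφ _ _ _ ?_
    simp only [Finset.mem_filter, Finset.mem_univ, true_and, Prod.mk.injEq] at hL
    rw [← hL.1, ← hL.2]
    exact hinv L
  · intro L _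
    simp only [Finset.mem_product, Nat.mem_divisors]
    exact ⟨⟨hp.m_dvd (hinv L), hp.m_pos.ne'⟩, hp.n_dvd (hinv L), hp.n_pos.ne'⟩

lemma card_subgroups (h : IsZMTriple m n r) : Nat.card (Subgroup (ZM m n r)) =
    ∑ m₁ ∈ m.divisors, ∑ n₁ ∈ n.divisors, Nat.gcd m₁ (powQuot n r n₁) := by
  have := h.isZMPair.finite
  have := Fintype.ofFinite (Subgroup (ZM m n r))
  rw [Nat.card_eq_fintype_card, Fintype.card_eq_sum_ones,
    h.sum_subgroups (fun _ => 1) (fun _ _ => 1) (fun _ _ _ _ => rfl)]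
  simp

/-- The permuting pairs with join `L` are exactly the factorizations of `L`. -/
lemma card_commuting (h : IsZMTriple m n r) :
    Nat.card {p : Subgroup (ZM m n r) × Subgroup (ZM m n r) //
      (p.1 : Set (ZM m n r)) * (p.2 : Set (ZM m n r)) =
        (p.2 : Set (ZM m n r)) * (p.1 : Set (ZM m n r))} =
    ∑ m₁ ∈ m.divisors, ∑ n₁ ∈ n.divisors,
      Nat.gcd m₁ (powQuot n r n₁) * f m n r m₁ n₁ := by
  classical
  have := h.isZMPair.finite
  have := Fintype.ofFinite (Subgroup (ZM m n r))
  rw [← h.sum_subgroups (fun L => factorizationNumber L) (f m n r)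
    (fun _ _ _ hL => h.factorizationNumber_eq_f hL), Nat.card_eq_fintype_card,
    Fintype.card_subtype, Finset.card_eq_sum_card_fiberwise (f := fun p => p.1 ⊔ p.2)
      (t := Finset.univ) (fun _ _ => Finset.mem_coe.2 (Finset.mem_univ _))]
  refine Finset.sum_congr rfl fun L _ => ?_
  rw [factorizationNumber_subgroup, Nat.card_eq_fintype_card, Fintype.card_subtype,
    Finset.filter_filter]
  congr 1
  ext p
  simp only [Finset.mem_filter, Finset.mem_univ, true_and]
  exact (mul_eq_coe_iff _ _ _).symm

lemma subgroupCommutativityDegree_eq (h : IsZMTriple m n r) :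
    subgroupCommutativityDegree (ZM m n r) =
      (∑ m₁ ∈ m.divisors, ∑ n₁ ∈ n.divisors,
        (Nat.gcd m₁ (powQuot n r n₁) : ℚ) * (f m n r m₁ n₁ : ℚ)) /
      (∑ m₁ ∈ m.divisors, ∑ n₁ ∈ n.divisors, (Nat.gcd m₁ (powQuot n r n₁) : ℚ)) ^ 2 := by
  rw [subgroupCommutativityDegree, h.card_commuting, h.card_subgroups]
  push_cast
  rfl

end IsZMTriple

/-! ### The example and the theorem -/

lemma isZMTriple_nine_four_eight : IsZMTriple 9 4 8 where
  m_pos := by norm_num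
  n_pos := by norm_num
  coprime := by norm_num
  coprime_sub_one := ⟨4, -5, by norm_num⟩
  pow_modEq := by decide

end ZMGroup

theorem theorem4p2 :
    (∀ m n r : ℕ, ZMGroup.IsZMTriple m n r →
      ZMGroup.subgroupCommutativityDegree (ZMGroup.ZM m n r) =
          (∑ m₁ ∈ m.divisors, ∑ n₁ ∈ n.divisors,
            (Nat.gcd m₁ (ZMGroup.powQuot n r n₁) : ℚ) * (ZMGroup.f m n r m₁ n₁ : ℚ)) /
          (∑ m₁ ∈ m.divisors, ∑ n₁ ∈ n.divisors,
            (Nat.gcd m₁ (ZMGroup.powQuot n r n₁) : ℚ)) ^ 2 ∧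
      ∀ m₁ ∈ m.divisors, ∀ n₁ ∈ n.divisors,
        ZMGroup.f m n r m₁ n₁ =
          ∑ p ∈ (m.divisors ×ˢ m.divisors).filter (fun p => Nat.gcd p.1 p.2 = m₁),
            ∑ q ∈ (n.divisors ×ˢ n.divisors).filter (fun q => Nat.gcd q.1 q.2 = n₁),
              Nat.gcd (p.1 / m₁) (ZMGroup.powQuot n r q.1) *
                Nat.gcd (p.2 / m₁) (ZMGroup.powQuot n r q.2)) ∧
    ZMGroup.subgroupCommutativityDegree (ZMGroup.ZM 9 4 8) = 13 / 19 := by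
  refine ⟨fun m n r h => ⟨h.subgroupCommutativityDegree_eq, fun m₁ hm₁ n₁ hn₁ =>
    h.f_eq (Nat.dvd_of_mem_divisors hm₁) (Nat.dvd_of_mem_divisors hn₁)⟩, ?_⟩
  have h := ZMGroup.isZMTriple_nine_four_eight
  have hnum : ∑ m₁ ∈ Nat.divisors 9, ∑ n₁ ∈ Nat.divisors 4,
      Nat.gcd m₁ (ZMGroup.powQuot 4 8 n₁) * ZMGroup.f 9 4 8 m₁ n₁ = 247 := by
    -- `f` counts subgroups and cannot be evaluated directly; its gcd formula can. The result is
    -- `247 / 19 ^ 2` with `247 = 13 * 19`.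
    rw [Finset.sum_congr rfl fun m₁ hm₁ => Finset.sum_congr rfl fun n₁ hn₁ => by
      rw [h.f_eq (Nat.dvd_of_mem_divisors hm₁) (Nat.dvd_of_mem_divisors hn₁)]]
    decide +kernel
  have hden : ∑ m₁ ∈ Nat.divisors 9, ∑ n₁ ∈ Nat.divisors 4,
      Nat.gcd m₁ (ZMGroup.powQuot 4 8 n₁) = 19 := by
    decide +kernel
  rw [ZMGroup.subgroupCommutativityDegree, h.card_commuting, h.card_subgroups, hnum, hden]
  norm_num
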